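/- Let $\Omega\subset\mathbb{R}^N$ be a non-empty bounded open set with boundary of class $C^1$ and outward unit normal $\nu$, let $\theta\in C^1(\Omega)$ be bounded above, let $a,b\in\mathbb{R}$ be not both zero, and let $\lambda,\gamma>0$. Let $\mathbb{X}$ be the set of $h\in C^2(\mathbb{R})$ such that either $h(0)<0$ and $h''(t)\ge 0$ for all $t>0$, or $h(0)=0$ and $h''(t)>0$ for all $t>0$; let $\mathbb{Y}$ be the set of $h\in C^2(\mathbb{R})$ such that either $h(0)>0$ and $h''(t)\le 0$ for all $t>0$, or $h(0)=0$ and $h''(t)<0$ for all $t>0$. Let $f,g:\mathbb{R}\to\mathbb{R}$, and let $u,v\in C^2(\Omega)\cap C^1(\overline\Omega)$ be positive in $\Omega$ and satisfy $$-\operatorname{div}(e^\theta\nabla u)=\lambda e^\theta f(v),\qquad -\operatorname{div}(e^\theta\nabla v)=\gamma e^\theta g(u)\quad\text{in }\Omega,$$ $$au+b\,\partial_\nu u=0,\qquad av+b\,\partial_\nu v=0\quad\text{on }\partial\Omega.$$ Consider the linearised problem, for $\eta\in\mathbb{R}$ and $\phi,\psi\in C^2(\Omega)\cap C^1(\overline\Omega)$: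 $$-\operatorname{div}(e^\theta\nabla\phi)=\lambda e^\theta f'(v)\psi+\eta\phi,\qquad -\operatorname{div}(e^\theta\nabla\psi)=\gamma e^\theta g'(u)\phi+\eta\psi\quad\text{in }\Omega,$$ $$a\phi+b\,\partial_\nu\phi=0,\qquad a\psi+b\,\partial_\nu\psi=0\quad\text{on }\partial\Omega.$$ A real number $\eta$ is an eigenvalue if this has a solution $(\phi,\psi)\not\equiv(0,0)$ in $\Omega$; it is the first eigenvalue if it is the least real eigenvalue and has an eigenfunction pair with $\phi>0$ and $\psi>0$ in $\Omega$. The solution $(u,v)$ is called stable if it has a first eigenvalue $\eta>0$, semi-stable if it has a first eigenvalue $\eta\ge0$, and unstable if it is not semi-stable. (i) If $f,g\in\mathbb{X}$, then $(u,v)$ is unstable; moreover, every $\eta$ for which the linearised problem has an eigenfunction pair that is positive in $\Omega$ satisfies $\eta<0$ (in particular the first eigenvalue, if there is one, is negative). (ii) If $f,g\in\mathbb{Y}$, then $(u,v)$ is stable, provided that the linearised problem has a first eigenvalue; moreover, every $\eta$ for which the linearised problem has an eigenfunction pair that is positive in $\Omega$ satisfies $\eta>0$. -/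

import Mathlib

open Filter Topology

noncomputable section

namespace RobinSystem

/-- Euclidean space of dimension `N`. -/
abbrev E (N : ℕ) : Type := EuclideanSpace ℝ (Fin N)

/-- The class of convex nonlinearities. -/
def ClassX : Set (ℝ → ℝ) :=
  {h | ContDiff ℝ 2 h ∧
    ((h 0 < 0 ∧ ∀ t : ℝ, 0 < t → 0 ≤ iteratedDeriv 2 h t) ∨
     (h 0 = 0 ∧ ∀ t : ℝ, 0 < t → 0 < iteratedDeriv 2 h t))}

/-- The class of concave nonlinearities. -/
def ClassY : Set (ℝ → ℝ) :=
  {h | ContDiff ℝ 2 h ∧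
    ((0 < h 0 ∧ ∀ t : ℝ, 0 < t → iteratedDeriv 2 h t ≤ 0) ∨
     (h 0 = 0 ∧ ∀ t : ℝ, 0 < t → iteratedDeriv 2 h t < 0))}

/-- `ρ` is a `C^1` local defining function of `Ω` at the boundary point `p`: near `p`, `Ω` is the
set where `ρ` is negative, and the gradient of `ρ` does not vanish at `p`. -/
def IsLocalDefiningFunction {N : ℕ} (Ω : Set (E N)) (p : E N) (ρ : E N → ℝ) : Prop :=
  ContDiffAt ℝ 1 ρ p ∧ ρ p = 0 ∧ gradient ρ p ≠ 0 ∧ ∀ᶠ x in 𝓝 p, (x ∈ Ω ↔ ρ x < 0)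

/-- `Ω` has a boundary of class `C^1` (and lies locally on one side of it). -/
def HasC1Boundary {N : ℕ} (Ω : Set (E N)) : Prop :=
  ∀ p ∈ frontier Ω, ∃ ρ : E N → ℝ, IsLocalDefiningFunction Ω p ρ

/-- `n` is the outward unit normal of `Ω` at the boundary point `p`. -/
def IsOutwardUnitNormal {N : ℕ} (Ω : Set (E N)) (p n : E N) : Prop :=
  ∃ ρ : E N → ℝ, IsLocalDefiningFunction Ω p ρ ∧ n = ‖gradient ρ p‖⁻¹ • gradient ρ p

/-- The divergence of a vector field. -/
def divergence {N : ℕ} (F : E N → E N) (x : E N) : ℝ :=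
  ∑ i : Fin N, (fderiv ℝ F x (EuclideanSpace.single i 1)) i

/-- The operator `w ↦ div (e^θ ∇w)`. -/
def weightedLaplacian {N : ℕ} (θ w : E N → ℝ) (x : E N) : ℝ :=
  divergence (fun y => Real.exp (θ y) • gradient w y) x

/-- `w` is of class `C^2(Ω) ∩ C^1(closure Ω)`: it is `C^2` in `Ω`, and `w` and its gradient
extend continuously to the closure. -/
def IsClassical {N : ℕ} (Ω : Set (E N)) (w : E N → ℝ) : Prop :=
  ContDiffOn ℝ 2 w Ω ∧ ContinuousOn w (closure Ω) ∧
    ∀ p ∈ closure Ω, ∃ G : E N, Tendsto (gradient w) (𝓝[Ω] p) (𝓝 G)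

/-- The derivative of `w` in the direction `n` at the boundary point `p`, computed with the
continuous extension of the gradient from `Ω` to the closure of `Ω`. -/
def boundaryDeriv {N : ℕ} (Ω : Set (E N)) (w : E N → ℝ) (p n : E N) : ℝ :=
  inner ℝ (extendFrom Ω (gradient w) p) n

/-- The boundary condition `a w + b ∂_ν w = 0` on the boundary of `Ω`. -/
def RobinCondition {N : ℕ} (Ω : Set (E N)) (a b : ℝ) (w : E N → ℝ) : Prop :=
  ∀ p ∈ frontier Ω, ∀ n : E N, IsOutwardUnitNormal Ω p n →
    a * w p + b * boundaryDeriv Ω w p n = 0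

/-- `(u, v)` is a positive classical solution of `-div (e^θ ∇u) = lam e^θ f(v)`,
`-div (e^θ ∇v) = gam e^θ g(u)` in `Ω` with the boundary conditions `a u + b ∂_ν u = 0`,
`a v + b ∂_ν v = 0`. -/
structure IsPositiveSolution {N : ℕ} (Ω : Set (E N)) (θ : E N → ℝ) (a b lam gam : ℝ)
    (f g : ℝ → ℝ) (u v : E N → ℝ) : Prop where
  classical_u : IsClassical Ω u
  classical_v : IsClassical Ω v
  pos_u : ∀ x ∈ Ω, 0 < u x
  pos_v : ∀ x ∈ Ω, 0 < v x
  eq_u : ∀ x ∈ Ω, -weightedLaplacian θ u x = lam * Real.exp (θ x) * f (v x)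
  eq_v : ∀ x ∈ Ω, -weightedLaplacian θ v x = gam * Real.exp (θ x) * g (u x)
  robin_u : RobinCondition Ω a b u
  robin_v : RobinCondition Ω a b v

/-- `(φ, ψ)` solves the linearised problem at `(u, v)` with the parameter `η`. -/
structure SolvesLinearised {N : ℕ} (Ω : Set (E N)) (θ : E N → ℝ) (a b lam gam : ℝ)
    (f g : ℝ → ℝ) (u v : E N → ℝ) (η : ℝ) (φ ψ : E N → ℝ) : Prop where
  classical_φ : IsClassical Ω φ
  classical_ψ : IsClassical Ω ψ
  eq_φ : ∀ x ∈ Ω, -weightedLaplacian θ φ x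
    = lam * Real.exp (θ x) * deriv f (v x) * ψ x + η * φ x
  eq_ψ : ∀ x ∈ Ω, -weightedLaplacian θ ψ x
    = gam * Real.exp (θ x) * deriv g (u x) * φ x + η * ψ x
  robin_φ : RobinCondition Ω a b φ
  robin_ψ : RobinCondition Ω a b ψ

/-- `η` is a (real) eigenvalue of the linearised problem at `(u, v)`. -/
def IsEigenvalue {N : ℕ} (Ω : Set (E N)) (θ : E N → ℝ) (a b lam gam : ℝ)
    (f g : ℝ → ℝ) (u v : E N → ℝ) (η : ℝ) : Prop :=
  ∃ φ ψ : E N → ℝ, SolvesLinearised Ω θ a b lam gam f g u v η φ ψ ∧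
    ∃ x ∈ Ω, φ x ≠ 0 ∨ ψ x ≠ 0

/-- The linearised problem at `(u, v)` has, for the parameter `η`, an eigenfunction pair that is
positive in `Ω`. -/
def HasPositiveEigenpair {N : ℕ} (Ω : Set (E N)) (θ : E N → ℝ) (a b lam gam : ℝ)
    (f g : ℝ → ℝ) (u v : E N → ℝ) (η : ℝ) : Prop :=
  ∃ φ ψ : E N → ℝ, SolvesLinearised Ω θ a b lam gam f g u v η φ ψ ∧
    (∀ x ∈ Ω, 0 < φ x) ∧ ∀ x ∈ Ω, 0 < ψ x

/-- `η` is the first eigenvalue of the linearised problem at `(u, v)`: the least eigenvalue, with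
a positive eigenfunction pair. -/
def IsFirstEigenvalue {N : ℕ} (Ω : Set (E N)) (θ : E N → ℝ) (a b lam gam : ℝ)
    (f g : ℝ → ℝ) (u v : E N → ℝ) (η : ℝ) : Prop :=
  IsLeast {μ : ℝ | IsEigenvalue Ω θ a b lam gam f g u v μ} η ∧
    HasPositiveEigenpair Ω θ a b lam gam f g u v η

/-- The first eigenvalue is positive. -/
def IsStable {N : ℕ} (Ω : Set (E N)) (θ : E N → ℝ) (a b lam gam : ℝ)
    (f g : ℝ → ℝ) (u v : E N → ℝ) : Prop :=
  ∃ η : ℝ, 0 < η ∧ IsFirstEigenvalue Ω θ a b lam gam f g u v η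

/-- The first eigenvalue is non-negative. -/
def IsSemiStable {N : ℕ} (Ω : Set (E N)) (θ : E N → ℝ) (a b lam gam : ℝ)
    (f g : ℝ → ℝ) (u v : E N → ℝ) : Prop :=
  ∃ η : ℝ, 0 ≤ η ∧ IsFirstEigenvalue Ω θ a b lam gam f g u v η

/-- Unstable means not semi-stable. -/
def IsUnstable {N : ℕ} (Ω : Set (E N)) (θ : E N → ℝ) (a b lam gam : ℝ)
    (f g : ℝ → ℝ) (u v : E N → ℝ) : Prop :=
  ¬ IsSemiStable Ω θ a b lam gam f g u v

end RobinSystem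

end

open MeasureTheory
open scoped Manifold ContDiff

namespace RobinSystem

variable {N : ℕ}


/-! Write `L w = div (e^θ ∇w)`. Multiply the equations for `u` and `ψ` crosswise, likewise those for
`v` and `φ`, and integrate. If `L` is symmetric under the Robin condition, adding the results gives
`∫ e^θ (lam (v f'(v) - f(v)) ψ + gam (u g'(u) - g(u)) φ) + η ∫ (u ψ + v φ) = 0`. The function `t
h'(t) - h(t)` has derivative `t h''(t)` and value `-h(0)` at `0`, so for `t > 0` it is positive on
`ClassX` and negative on `ClassY`. With `φ, ψ > 0` this fixes the sign of `η`.

The work lies in the symmetry (`setIntegral_mul_weightedLaplacian_sub`). Since `θ` is only bounded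
above, `e^θ ∇w` need not extend to the boundary. But the field `w e^θ ∇z - z e^θ ∇w` is bounded, and
its normal component tends to `0` at the boundary. For such fields with integrable divergence,
`setIntegral_divergence_eq_zero_of_tangential` gives a divergence theorem without surface measure:
localise by a partition of unity, cut off in a thin layer at the boundary, and let the layer shrink.
The layer weights have bounded mass, as testing a constant transversal field shows, so the boundary
term vanishes in the limit. -/

/-! ### Divergence and its weak form for compact support -/

theorem sum_coord_mul_apply (L : E N →L[ℝ] ℝ) (y : E N) :
    ∑ i : Fin N, L (EuclideanSpace.single i 1) * y i = L y := by
  have h : y = ∑ i : Fin N, y i • (EuclideanSpace.single i (1 : ℝ) : E N) := by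
    ext j
    simp [Pi.single_apply]
  conv_rhs => rw [h]
  simp [mul_comm]

theorem divergence_smul {g : E N → ℝ} {F : E N → E N} {x : E N}
    (hg : DifferentiableAt ℝ g x) (hF : DifferentiableAt ℝ F x) :
    divergence (fun y => g y • F y) x = g x * divergence F x + fderiv ℝ g x (F x) := by
  unfold divergence
  rw [fderiv_fun_smul hg hF, ← sum_coord_mul_apply (fderiv ℝ g x) (F x), Finset.mul_sum,
    ← Finset.sum_add_distrib]
  simp

theorem divergence_add {F G : E N → E N} {x : E N}
    (hF : DifferentiableAt ℝ F x) (hG : DifferentiableAt ℝ G x) :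
    divergence (fun y => F y + G y) x = divergence F x + divergence G x := by
  unfold divergence
  rw [fderiv_fun_add hF hG, ← Finset.sum_add_distrib]
  simp

theorem divergence_sub {F G : E N → E N} {x : E N}
    (hF : DifferentiableAt ℝ F x) (hG : DifferentiableAt ℝ G x) :
    divergence (fun y => F y - G y) x = divergence F x - divergence G x := by
  unfold divergence
  rw [fderiv_fun_sub hF hG, ← Finset.sum_sub_distrib]
  simp

/-- Integration by parts against the constant `1`; only products with `g` or its derivative need to
be integrable. -/
theorem integral_fderiv_apply_eq_zero {g : E N → ℝ} (hg : ContDiff ℝ 1 g)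
    (hs : HasCompactSupport g) (e : E N) : ∫ x, fderiv ℝ g x e = 0 := by
  have hs' : HasCompactSupport fun x => fderiv ℝ g x e := hs.fderiv_apply ℝ e
  have hc : Continuous fun x => fderiv ℝ g x e :=
    (hg.continuous_fderiv one_ne_zero).clm_apply continuous_const
  have h := integral_mul_fderiv_eq_neg_fderiv_mul_of_integrable (μ := (volume : Measure (E N)))
    (f := fun _ => (1 : ℝ)) (g := g) (v := e) (by simp)
    (by simpa using hc.integrable_of_hasCompactSupport hs')
    (by simpa using hg.continuous.integrable_of_hasCompactSupport hs)
    (fun _ _ => differentiableAt_const _)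
    (fun x _ => hg.differentiable one_ne_zero x)
  simpa using h

theorem integral_divergence_eq_zero {F : E N → E N} (hF : ContDiff ℝ 1 F)
    (hs : HasCompactSupport F) : ∫ x, divergence F x = 0 := by
  have hcoord : ∀ i : Fin N, ContDiff ℝ 1 fun x => F x i := fun i => by fun_prop
  have hsi : ∀ i : Fin N, HasCompactSupport fun x => F x i := fun i =>
    hs.comp_left (g := fun y : E N => y i) rfl
  have hd : ∀ (i : Fin N) (x : E N), (fderiv ℝ F x (EuclideanSpace.single i 1)) i
      = fderiv ℝ (fun y => F y i) x (EuclideanSpace.single i 1) := fun i x => by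
    have h := ((EuclideanSpace.proj (𝕜 := ℝ) i).hasFDerivAt.comp x
      (hF.differentiable one_ne_zero x).hasFDerivAt).fderiv
    have h' : (⇑(EuclideanSpace.proj (𝕜 := ℝ) i) ∘ F) = fun y => F y i := rfl
    rw [h'] at h
    rw [h]
    rfl
  unfold divergence
  simp_rw [hd]
  rw [integral_finsetSum]
  · exact Finset.sum_eq_zero fun i _ => integral_fderiv_apply_eq_zero (hcoord i) (hsi i) _
  · intro i _
    exact (((hcoord i).continuous_fderiv one_ne_zero).clm_apply
      continuous_const).integrable_of_hasCompactSupport ((hsi i).fderiv_apply ℝ _)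

theorem divergence_eq_zero_of_notMem_tsupport {F : E N → E N} {x : E N} (hx : x ∉ tsupport F) :
    divergence F x = 0 := by
  have : fderiv ℝ F x = 0 := by
    by_contra h
    exact hx (support_fderiv_subset ℝ h)
  simp [divergence, this]

/-- The weak form of the divergence, tested against a function compactly supported in `Ω`. -/
theorem setIntegral_smul_divergence_add_fderiv {Ω : Set (E N)} (hΩ : IsOpen Ω)
    {F : E N → E N} (hF : ContDiffOn ℝ 1 F Ω) {ζ : E N → ℝ} (hζ : ContDiff ℝ 1 ζ)
    (hs : HasCompactSupport ζ) (hsub : tsupport ζ ⊆ Ω) :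
    ∫ x in Ω, (ζ x * divergence F x + fderiv ℝ ζ x (F x)) = 0 := by
  have hH : ContDiff ℝ 1 fun x => ζ x • F x := by
    rw [contDiff_iff_contDiffAt]
    intro x
    by_cases hx : x ∈ tsupport ζ
    · exact hζ.contDiffAt.smul (hF.contDiffAt (hΩ.mem_nhds (hsub hx)))
    · have h0 : (fun x => ζ x • F x) =ᶠ[𝓝 x] fun _ => 0 := by
        filter_upwards [notMem_tsupport_iff_eventuallyEq.1 hx] with y hy
        simp [hy]
      exact contDiffAt_const.congr_of_eventuallyEq h0
  have hHs : HasCompactSupport fun x => ζ x • F x := hs.smul_right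
  have hcongr : ∀ x ∈ Ω, ζ x * divergence F x + fderiv ℝ ζ x (F x)
      = divergence (fun x => ζ x • F x) x := fun x hx =>
    (divergence_smul (hζ.differentiable one_ne_zero x)
      ((hF.differentiableOn one_ne_zero).differentiableAt (hΩ.mem_nhds hx))).symm
  rw [setIntegral_congr_fun hΩ.measurableSet hcongr,
    setIntegral_eq_integral_of_forall_compl_eq_zero, integral_divergence_eq_zero hH hHs]
  intro x hx
  refine divergence_eq_zero_of_notMem_tsupport fun h => hx (hsub ?_)
  exact closure_mono (Function.support_smul_subset_left ζ F) h


/-! ### Boundary-layer cut-offs and the local divergence theorem -/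

theorem smoothTransition_deriv_nonneg (t : ℝ) : 0 ≤ deriv Real.smoothTransition t :=
  Real.smoothTransition.monotone.deriv_nonneg

theorem smoothTransition_deriv_eq_zero {t : ℝ} (ht : t < 0 ∨ 1 < t) :
    deriv Real.smoothTransition t = 0 := by
  rcases ht with ht | ht
  · have h : Real.smoothTransition =ᶠ[𝓝 t] fun _ => 0 := by
      filter_upwards [Iio_mem_nhds ht] with s hs
      exact Real.smoothTransition.zero_of_nonpos (le_of_lt hs)
    simp [h.deriv_eq]
  · have h : Real.smoothTransition =ᶠ[𝓝 t] fun _ => 1 := by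
      filter_upwards [Ioi_mem_nhds ht] with s hs
      exact Real.smoothTransition.one_of_one_le (le_of_lt hs)
    simp [h.deriv_eq]

/-- A `C^1` cut-off that is `0` where `-1/k ≤ ρ` and `1` where `ρ ≤ -2/k`. -/
noncomputable def cutoff (ρ : E N → ℝ) (k : ℕ) (x : E N) : ℝ :=
  Real.smoothTransition (-(k * ρ x) - 1)

/-- The density `ζ h'(-kρ - 1) k` by which `∇ρ` enters the gradient of `ζ` times the cut-off. -/
noncomputable def cutoffWeight (ρ ζ : E N → ℝ) (k : ℕ) (x : E N) : ℝ :=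
  ζ x * (k * deriv Real.smoothTransition (-(k * ρ x) - 1))

theorem contDiff_cutoff {ρ : E N → ℝ} (hρ : ContDiff ℝ 1 ρ) (k : ℕ) :
    ContDiff ℝ 1 (cutoff ρ k) := by
  unfold cutoff
  exact Real.smoothTransition.contDiff.comp (by fun_prop)

theorem cutoff_nonneg (ρ : E N → ℝ) (k : ℕ) (x : E N) : 0 ≤ cutoff ρ k x :=
  Real.smoothTransition.nonneg _

theorem cutoff_le_one (ρ : E N → ℝ) (k : ℕ) (x : E N) : cutoff ρ k x ≤ 1 :=
  Real.smoothTransition.le_one _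

theorem cutoff_eq_zero {ρ : E N → ℝ} {k : ℕ} {x : E N} (h : -1 ≤ k * ρ x) :
    cutoff ρ k x = 0 :=
  Real.smoothTransition.zero_of_nonpos (by linarith)

theorem eventually_cutoff_eq_one {ρ : E N → ℝ} {x : E N} (h : ρ x < 0) :
    ∀ᶠ k : ℕ in atTop, cutoff ρ k x = 1 := by
  have ht : Tendsto (fun k : ℕ => (k : ℝ) * -ρ x) atTop atTop :=
    tendsto_natCast_atTop_atTop.atTop_mul_const (by linarith)
  filter_upwards [ht.eventually_ge_atTop 2] with k hk
  exact Real.smoothTransition.one_of_one_le (by linarith)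

theorem continuous_cutoffWeight {ρ ζ : E N → ℝ} (hρ : ContDiff ℝ 1 ρ) (hζ : Continuous ζ) (k : ℕ) :
    Continuous (cutoffWeight ρ ζ k) := by
  unfold cutoffWeight
  have h1 : Continuous (deriv Real.smoothTransition) :=
    (Real.smoothTransition.contDiff (n := 1)).continuous_deriv le_rfl
  have h2 := hρ.continuous
  fun_prop

theorem cutoffWeight_nonneg {ρ ζ : E N → ℝ} (hζ : ∀ x, 0 ≤ ζ x) (k : ℕ) (x : E N) :
    0 ≤ cutoffWeight ρ ζ k x :=
  mul_nonneg (hζ x) (mul_nonneg k.cast_nonneg (smoothTransition_deriv_nonneg _))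

theorem cutoffWeight_eq_zero {ρ ζ : E N → ℝ} {k : ℕ} {x : E N} (h : k * ρ x < -2) :
    cutoffWeight ρ ζ k x = 0 := by
  unfold cutoffWeight
  rw [smoothTransition_deriv_eq_zero (Or.inr (by linarith))]
  simp

theorem fderiv_mul_cutoff {ρ ζ : E N → ℝ} (hρ : ContDiff ℝ 1 ρ) (hζ : ContDiff ℝ 1 ζ) (k : ℕ)
    (x y : E N) : fderiv ℝ (fun z => ζ z * cutoff ρ k z) x y
      = cutoff ρ k x * fderiv ℝ ζ x y - cutoffWeight ρ ζ k x * fderiv ℝ ρ x y := by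
  have h1 : HasFDerivAt (fun z => -((k : ℝ) * ρ z) - 1) (-((k : ℝ) • fderiv ℝ ρ x)) x :=
    (((hρ.differentiable one_ne_zero x).hasFDerivAt.const_mul (k : ℝ)).neg).sub_const 1
  have h2 : HasDerivAt Real.smoothTransition _ (-((k : ℝ) * ρ x) - 1) :=
    ((Real.smoothTransition.contDiff (n := 1)).differentiable one_ne_zero _).hasDerivAt
  have h3 : HasFDerivAt (cutoff ρ k) _ x := h2.comp_hasFDerivAt x h1
  have h4 : HasFDerivAt (fun z => ζ z * cutoff ρ k z) _ x :=
    (hζ.differentiable one_ne_zero x).hasFDerivAt.mul h3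
  rw [h4.fderiv]
  simp only [add_apply, smul_apply, neg_apply, smul_eq_mul, cutoffWeight]
  ring

/-- The closed set `k ρ ≤ -1` already contains the support and stays away from `ρ = 0`. Hence a `ζ`
whose support crosses the boundary becomes admissible for the interior weak form. -/
theorem tsupport_mul_cutoff_subset {ρ ζ : E N → ℝ} (hρ : Continuous ρ) (k : ℕ) :
    tsupport (fun z => ζ z * cutoff ρ k z) ⊆ tsupport ζ ∩ {x | ρ x < 0} := by
  have hsub : tsupport (fun z => ζ z * cutoff ρ k z) ⊆ tsupport ζ ∩ {x | k * ρ x ≤ -1} := by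
    refine closure_minimal (fun x hx => ?_) ((isClosed_tsupport ζ).inter
      (isClosed_le (by fun_prop) continuous_const))
    refine ⟨subset_tsupport ζ (left_ne_zero_of_mul hx), ?_⟩
    by_contra h
    exact right_ne_zero_of_mul hx (cutoff_eq_zero (not_le.1 h).le)
  refine hsub.trans (Set.inter_subset_inter_right _ fun x hx => ?_)
  by_contra h
  have h1 : (k : ℝ) * ρ x ≤ -1 := hx
  have := mul_nonneg (k.cast_nonneg (α := ℝ)) (not_lt.1 h)
  linarith

/-- A vector field whose component along `∇ρ` vanishes at the boundary is uniformly almost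
tangential near the boundary. -/
theorem exists_forall_abs_fderiv_le {Ω K : Set (E N)} (hΩ : IsOpen Ω) {F : E N → E N}
    {ρ : E N → ℝ} (hρ : Continuous ρ) (hK : IsCompact K)
    (hKρ : ∀ x ∈ K, x ∈ Ω ↔ ρ x < 0)
    (hlim : ∀ q ∈ K, q ∈ frontier Ω →
      Tendsto (fun x => fderiv ℝ ρ x (F x)) (𝓝[Ω] q) (𝓝 0)) {δ : ℝ} (hδ : 0 < δ) :
    ∃ ε > 0, ∀ x ∈ K, x ∈ Ω → -ε ≤ ρ x → |fderiv ℝ ρ x (F x)| ≤ δ := by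
  -- The bound passes to subsets and finite unions, so compactness reduces it to a neighbourhood of
  -- each point.
  refine hK.induction_on (p := fun s => ∃ ε > 0, ∀ x ∈ s, x ∈ Ω → -ε ≤ ρ x →
    |fderiv ℝ ρ x (F x)| ≤ δ) ⟨1, one_pos, by simp⟩ ?_ ?_ ?_
  · rintro s t hst ⟨ε, hε, h⟩
    exact ⟨ε, hε, fun x hx => h x (hst hx)⟩
  · rintro s t ⟨ε, hε, h⟩ ⟨ε', hε', h'⟩
    refine ⟨min ε ε', lt_min hε hε', ?_⟩
    rintro x (hx | hx) hxΩ hxρ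
    · exact h x hx hxΩ (le_trans (neg_le_neg (min_le_left _ _)) hxρ)
    · exact h' x hx hxΩ (le_trans (neg_le_neg (min_le_right _ _)) hxρ)
  · intro q hq
    by_cases hqΩ : q ∈ Ω
    · have hneg := (hKρ q hq).1 hqΩ
      -- Near an interior point the choice `ε = -ρ q / 2` makes the layer condition vacuous.
      refine ⟨{x | ρ x < ρ q / 2}, mem_nhdsWithin_of_mem_nhds
        ((isOpen_lt hρ continuous_const).mem_nhds ?_), -(ρ q / 2), by linarith, ?_⟩
      · show ρ q < ρ q / 2
        linarith
      · intro x hx _ hxρ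
        have hx' : ρ x < ρ q / 2 := hx
        linarith
    by_cases hqf : q ∈ closure Ω
    · have hfr : q ∈ frontier Ω := by
        rw [hΩ.frontier_eq]
        exact ⟨hqf, hqΩ⟩
      have hev := (hlim q hq hfr).eventually (Metric.closedBall_mem_nhds 0 hδ)
      rw [eventually_nhdsWithin_iff] at hev
      refine ⟨_, mem_nhdsWithin_of_mem_nhds hev, 1, one_pos, ?_⟩
      intro x hx hxΩ _
      simpa using hx hxΩ
    · refine ⟨(closure Ω)ᶜ, mem_nhdsWithin_of_mem_nhds
        (isClosed_closure.isOpen_compl.mem_nhds hqf), 1, one_pos, ?_⟩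
      intro x hx hxΩ
      exact absurd (subset_closure hxΩ) hx

theorem integrableOn_covector_apply {Ω : Set (E N)} (hΩ : IsOpen Ω) {F : E N → E N}
    (hF : ContinuousOn F Ω) {M : ℝ} (hM : ∀ x ∈ Ω, ‖F x‖ ≤ M) {A : E N → (E N →L[ℝ] ℝ)}
    (hA : Continuous A) (hAs : HasCompactSupport A) : IntegrableOn (fun x => A x (F x)) Ω := by
  have hb : Integrable (fun x => ‖A x‖ * M) (volume.restrict Ω) :=
    ((hA.norm.integrable_of_hasCompactSupport hAs.norm).mul_const M).integrableOn
  refine hb.mono' ?_ ?_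
  · exact (ContinuousLinearMap.apply ℝ ℝ).flip.aestronglyMeasurable_comp₂
      hA.aestronglyMeasurable (hF.aestronglyMeasurable hΩ.measurableSet)
  · refine (ae_restrict_mem hΩ.measurableSet).mono fun x hx => ?_
    exact ((A x).le_opNorm _).trans (mul_le_mul_of_nonneg_left (hM x hx) (norm_nonneg _))

theorem integrableOn_smul_divergence_add_fderiv {Ω : Set (E N)} (hΩ : IsOpen Ω)
    {F : E N → E N} (hF : ContinuousOn F Ω) {M : ℝ} (hM : ∀ x ∈ Ω, ‖F x‖ ≤ M)
    (hD : IntegrableOn (divergence F) Ω) {ζ : E N → ℝ} (hζ : ContDiff ℝ 1 ζ)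
    (hs : HasCompactSupport ζ) :
    IntegrableOn (fun x => ζ x * divergence F x + fderiv ℝ ζ x (F x)) Ω := by
  refine Integrable.add ?_ (integrableOn_covector_apply hΩ hF hM
    (hζ.continuous_fderiv one_ne_zero) (hs.fderiv ℝ))
  obtain ⟨C, hC⟩ := hζ.continuous.bounded_above_of_compact_support hs
  exact hD.bdd_mul hζ.continuous.aestronglyMeasurable (ae_of_all _ hC)

/-- The weak form of the divergence of a bounded field that is tangential at the boundary, tested
against a function supported near a boundary point. -/
theorem setIntegral_smul_divergence_add_fderiv_of_tangential {Ω U : Set (E N)} (hΩ : IsOpen Ω)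
    {F : E N → E N} (hF : ContDiffOn ℝ 1 F Ω) {M : ℝ} (hM : ∀ x ∈ Ω, ‖F x‖ ≤ M)
    (hD : IntegrableOn (divergence F) Ω) {ρ : E N → ℝ} (hρ : ContDiff ℝ 1 ρ)
    (hU : ∀ x ∈ U, x ∈ Ω ↔ ρ x < 0) {e : E N} {c : ℝ} (hc : 0 < c)
    (he : ∀ x ∈ U, c ≤ fderiv ℝ ρ x e)
    (hlim : ∀ q ∈ U, q ∈ frontier Ω → Tendsto (fun x => fderiv ℝ ρ x (F x)) (𝓝[Ω] q) (𝓝 0))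
    {ζ : E N → ℝ} (hζ : ContDiff ℝ 1 ζ) (hs : HasCompactSupport ζ) (hsub : tsupport ζ ⊆ U)
    (hζ0 : ∀ x, 0 ≤ ζ x) :
    ∫ x in Ω, (ζ x * divergence F x + fderiv ℝ ζ x (F x)) = 0 := by
  have hG := integrableOn_smul_divergence_add_fderiv hΩ hF.continuousOn hM hD hζ hs
  set G : E N → ℝ := fun x => ζ x * divergence F x + fderiv ℝ ζ x (F x) with hGdef
  set w := cutoffWeight ρ ζ with hw
  have hwc : ∀ k, Continuous (w k) := continuous_cutoffWeight hρ hζ.continuous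
  have hws : ∀ k, HasCompactSupport (w k) := fun k => hs.mul_right
  have hwi : ∀ k, IntegrableOn (w k) Ω := fun k =>
    ((hwc k).integrable_of_hasCompactSupport (hws k)).integrableOn
  have hwF : ∀ k, IntegrableOn (fun x => w k x * fderiv ℝ ρ x (F x)) Ω := fun k =>
    integrableOn_covector_apply hΩ hF.continuousOn hM (A := fun x => w k x • fderiv ℝ ρ x)
      ((hwc k).smul (hρ.continuous_fderiv one_ne_zero))
      (hws k).smul_right
  have hχG : ∀ k, IntegrableOn (fun x => cutoff ρ k x * G x) Ω := fun k =>
    hG.bdd_mul (c := 1) (contDiff_cutoff hρ k).continuous.aestronglyMeasurable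
      (ae_of_all _ fun x => by
        rw [Real.norm_of_nonneg (cutoff_nonneg ρ k x)]; exact cutoff_le_one ρ k x)
  have hsupp : ∀ k, tsupport (fun z => ζ z * cutoff ρ k z) ⊆ Ω := fun k x hx =>
    have h := tsupport_mul_cutoff_subset hρ.continuous k hx
    (hU x (hsub h.1)).2 h.2
  have hweak : ∀ k {F' : E N → E N}, ContDiffOn ℝ 1 F' Ω →
      ∫ x in Ω, (ζ x * cutoff ρ k x * divergence F' x
        + (cutoff ρ k x * fderiv ℝ ζ x (F' x) - w k x * fderiv ℝ ρ x (F' x))) = 0 := by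
    intro k F' hF'
    have h := setIntegral_smul_divergence_add_fderiv hΩ hF'
      (hζ.mul (contDiff_cutoff hρ k)) hs.mul_right (hsupp k)
    simp only [fderiv_mul_cutoff hρ hζ] at h
    exact h
  have hfield : ∀ k, ∫ x in Ω, w k x * fderiv ℝ ρ x (F x) = ∫ x in Ω, cutoff ρ k x * G x := by
    intro k
    have h := hweak k hF
    have h2 : ∫ x in Ω, (cutoff ρ k x * G x - w k x * fderiv ℝ ρ x (F x)) = 0 := by
      rw [← h]
      congr 1
      ext x
      simp only [hGdef]
      ring
    rw [integral_sub (hχG k) (hwF k)] at h2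
    linarith
  set B : ℝ := ∫ x in Ω, |fderiv ℝ ζ x e| with hB
  have hζe : IntegrableOn (fun x => fderiv ℝ ζ x e) Ω :=
    (((hζ.continuous_fderiv one_ne_zero).clm_apply
      continuous_const).integrable_of_hasCompactSupport (hs.fderiv_apply ℝ e)).integrableOn
  -- The constant field `e` has zero divergence and crosses the level sets of `ρ` at rate at least
  -- `c`, so the weak identity for it bounds the mass of `w k` independently of `k`.
  have hmass : ∀ k, c * ∫ x in Ω, w k x ≤ B := by
    intro k
    have h := hweak k (F' := fun _ => e) contDiffOn_const
    have hχe : IntegrableOn (fun x => cutoff ρ k x * fderiv ℝ ζ x e) Ω :=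
      hζe.bdd_mul (c := 1) (contDiff_cutoff hρ k).continuous.aestronglyMeasurable
        (ae_of_all _ fun x => by
          rw [Real.norm_of_nonneg (cutoff_nonneg ρ k x)]; exact cutoff_le_one ρ k x)
    have hwe : IntegrableOn (fun x => w k x * fderiv ℝ ρ x e) Ω :=
      (((hwc k).mul ((hρ.continuous_fderiv one_ne_zero).clm_apply
        continuous_const)).integrable_of_hasCompactSupport (hws k).mul_right).integrableOn
    have hdiv : ∀ x, divergence (fun _ : E N => e) x = 0 := fun x => by simp [divergence]
    simp only [hdiv, mul_zero, zero_add] at h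
    rw [integral_sub hχe hwe] at h
    calc c * ∫ x in Ω, w k x = ∫ x in Ω, c * w k x := (integral_const_mul _ _).symm
      _ ≤ ∫ x in Ω, w k x * fderiv ℝ ρ x e := by
          refine integral_mono ((hwi k).const_mul c) hwe fun x => ?_
          by_cases hx : x ∈ tsupport ζ
          · show c * w k x ≤ w k x * fderiv ℝ ρ x e
            rw [mul_comm]
            exact mul_le_mul_of_nonneg_left (he x (hsub hx)) (cutoffWeight_nonneg hζ0 k x)
          · simp [hw, cutoffWeight, image_eq_zero_of_notMem_tsupport hx]
      _ = ∫ x in Ω, cutoff ρ k x * fderiv ℝ ζ x e := by linarith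
      _ ≤ B := by
          refine integral_mono hχe hζe.abs fun x => ?_
          calc cutoff ρ k x * fderiv ℝ ζ x e ≤ cutoff ρ k x * |fderiv ℝ ζ x e| :=
                mul_le_mul_of_nonneg_left (le_abs_self _) (cutoff_nonneg ρ k x)
            _ ≤ 1 * |fderiv ℝ ζ x e| :=
                mul_le_mul_of_nonneg_right (cutoff_le_one ρ k x) (abs_nonneg _)
            _ = |fderiv ℝ ζ x e| := one_mul _
  have hconv : Tendsto (fun k => ∫ x in Ω, cutoff ρ k x * G x) atTop (𝓝 (∫ x in Ω, G x)) := by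
    refine tendsto_integral_of_dominated_convergence (fun x => ‖G x‖)
      (fun k => (hχG k).aestronglyMeasurable) hG.norm ?_ ?_
    · intro k
      refine ae_of_all _ fun x => ?_
      rw [norm_mul, Real.norm_of_nonneg (cutoff_nonneg ρ k x)]
      exact mul_le_of_le_one_left (norm_nonneg _) (cutoff_le_one ρ k x)
    · refine (ae_restrict_mem hΩ.measurableSet).mono fun x hx => ?_
      by_cases hxs : x ∈ tsupport ζ
      · refine tendsto_const_nhds.congr' ?_
        filter_upwards [eventually_cutoff_eq_one ((hU x (hsub hxs)).1 hx)] with k hk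
        simp [hk]
      · have h0 : G x = 0 := by
          have h1 : fderiv ℝ ζ x = 0 := by
            by_contra h
            exact hxs (support_fderiv_subset ℝ h)
          simp [hGdef, h1, image_eq_zero_of_notMem_tsupport hxs]
        simp [h0]
  have hsmall : ∀ δ > 0, |∫ x in Ω, G x| ≤ δ * (B / c) := by
    intro δ hδ
    obtain ⟨ε, hε, hεδ⟩ := exists_forall_abs_fderiv_le hΩ hρ.continuous hs
      (fun x hx => hU x (hsub hx)) (fun q hq => hlim q (hsub hq)) hδ
    refine le_of_tendsto hconv.abs ?_
    have ht : Tendsto (fun k : ℕ => (k : ℝ) * ε) atTop atTop :=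
      tendsto_natCast_atTop_atTop.atTop_mul_const hε
    -- Once `k ε > 2`, the weight vanishes where `ρ < -ε`; only the region where the field is
    -- `δ`-tangential remains.
    filter_upwards [ht.eventually_gt_atTop 2] with k hk
    rw [← hfield k]
    calc |∫ x in Ω, w k x * fderiv ℝ ρ x (F x)|
        ≤ ∫ x in Ω, |w k x * fderiv ℝ ρ x (F x)| := abs_integral_le_integral_abs
      _ ≤ ∫ x in Ω, δ * w k x := by
          refine setIntegral_mono_on (hwF k).abs ((hwi k).const_mul δ) hΩ.measurableSet ?_
          intro x hx
          rw [abs_mul, abs_of_nonneg (cutoffWeight_nonneg hζ0 k x), mul_comm]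
          by_cases hxs : x ∈ tsupport ζ
          · by_cases hxρ : -ε ≤ ρ x
            · exact mul_le_mul_of_nonneg_right (hεδ x hxs hx hxρ) (cutoffWeight_nonneg hζ0 k x)
            · have hk0 : (0 : ℝ) < k := by
                by_contra h
                have : (k : ℝ) * ε ≤ 0 := mul_nonpos_of_nonpos_of_nonneg (not_lt.1 h) hε.le
                linarith
              have h2 : (k : ℝ) * ρ x < -2 := by
                have := mul_lt_mul_of_pos_left (not_le.1 hxρ) hk0
                linarith
              simp [hw, cutoffWeight_eq_zero h2]
          · simp [hw, cutoffWeight, image_eq_zero_of_notMem_tsupport hxs]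
      _ = δ * ∫ x in Ω, w k x := integral_const_mul _ _
      _ ≤ δ * (B / c) := by
          refine mul_le_mul_of_nonneg_left ?_ hδ.le
          rw [le_div_iff₀ hc, mul_comm]
          exact hmass k
  have hlim0 : Tendsto (fun δ : ℝ => δ * (B / c)) (𝓝[>] 0) (𝓝 0) := by
    have h : Tendsto (fun δ : ℝ => δ * (B / c)) (𝓝 0) (𝓝 (0 * (B / c))) :=
      tendsto_id.mul_const _
    rw [zero_mul] at h
    exact h.mono_left nhdsWithin_le_nhds
  have hle : |∫ x in Ω, G x| ≤ 0 :=
    ge_of_tendsto hlim0 (eventually_nhdsWithin_of_forall fun δ hδ => hsmall δ hδ)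
  exact abs_nonpos_iff.1 hle


/-! ### Local defining functions and the global divergence theorem -/

theorem inner_gradient {w : E N → ℝ} (x y : E N) :
    inner ℝ (gradient w x) y = fderiv ℝ w x y := by
  rw [gradient, InnerProductSpace.toDual_symm_apply]

theorem inner_gradient_right {w : E N → ℝ} (x y : E N) :
    inner ℝ y (gradient w x) = fderiv ℝ w x y := by
  rw [real_inner_comm, inner_gradient]

theorem IsLocalDefiningFunction.congr {Ω : Set (E N)} {p : E N} {ρ ρ' : E N → ℝ}
    (h : IsLocalDefiningFunction Ω p ρ) (he : ρ' =ᶠ[𝓝 p] ρ) :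
    IsLocalDefiningFunction Ω p ρ' := by
  refine ⟨h.1.congr_of_eventuallyEq he, he.eq_of_nhds.trans h.2.1, ?_, ?_⟩
  · have : gradient ρ' p = gradient ρ p := by rw [gradient, gradient, he.fderiv_eq]
    rw [this]
    exact h.2.2.1
  · filter_upwards [h.2.2.2, he] with x hx hx'
    rw [hx, hx']

/-- A local defining function may be taken to be globally of class `C^1`. -/
theorem IsLocalDefiningFunction.exists_contDiff {Ω : Set (E N)} {p : E N} {ρ : E N → ℝ}
    (h : IsLocalDefiningFunction Ω p ρ) :
    ∃ ρ' : E N → ℝ, ContDiff ℝ 1 ρ' ∧ IsLocalDefiningFunction Ω p ρ' := by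
  obtain ⟨r, hr, hball⟩ := Metric.eventually_nhds_iff_ball.1 (h.1.eventually (by simp))
  -- The outer radius `r / 2` keeps the support inside the ball of radius `r` on which `ρ` is `C^1`.
  let β : ContDiffBump p := ⟨r / 3, r / 2, by positivity, by linarith⟩
  refine ⟨fun x => β x * ρ x, ?_, h.congr ?_⟩
  · rw [contDiff_iff_contDiffAt]
    intro x
    by_cases hx : x ∈ tsupport β
    · rw [β.tsupport_eq] at hx
      refine β.contDiff.contDiffAt.mul (hball x ?_)
      have h1 : dist x p ≤ r / 2 := hx
      exact Metric.mem_ball.2 (by linarith)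
    · have h0 : (fun x => β x * ρ x) =ᶠ[𝓝 x] fun _ => 0 := by
        filter_upwards [notMem_tsupport_iff_eventuallyEq.1 hx] with y hy
        simp [hy]
      exact contDiffAt_const.congr_of_eventuallyEq h0
  · filter_upwards [β.eventuallyEq_one] with x hx
    simp [hx]

/-- A single `ρ` thus yields the normals at all nearby boundary points. It vanishes there: a
positive value is excluded by points of `Ω` close by, and a negative one would put `q` in `Ω`. -/
theorem IsLocalDefiningFunction.eventually {Ω : Set (E N)} (hΩ : IsOpen Ω) {p : E N}
    {ρ : E N → ℝ} (hρ : ContDiff ℝ 1 ρ) (h : IsLocalDefiningFunction Ω p ρ) :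
    ∀ᶠ q in 𝓝 p, q ∈ frontier Ω → IsLocalDefiningFunction Ω q ρ := by
  have hg : Continuous (gradient ρ) :=
    (InnerProductSpace.toDual ℝ (E N)).symm.continuous.comp (hρ.continuous_fderiv one_ne_zero)
  filter_upwards [h.2.2.2.eventually_nhds, hg.continuousAt.eventually_ne h.2.2.1] with q hq hq'
  intro hqf
  rw [hΩ.frontier_eq] at hqf
  refine ⟨hρ.contDiffAt, le_antisymm ?_ ?_, hq', hq⟩
  · by_contra hpos
    have hev := (isOpen_lt continuous_const hρ.continuous).mem_nhds (not_le.1 hpos)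
    obtain ⟨y, ⟨hy1, hy2⟩, hy3⟩ := mem_closure_iff_nhds.1 hqf.1 _ (inter_mem hq hev)
    exact lt_asymm (hy1.1 hy3) hy2
  · by_contra hneg
    exact hqf.2 (hq.self_of_nhds.2 (not_le.1 hneg))

/-- With the differential frozen at `q` this is the hypothesis on the normal; the error is at most
`‖fderiv ℝ ρ x - fderiv ℝ ρ q‖ * M`, which tends to `0`. -/
theorem tendsto_fderiv_apply_of_tangential {Ω : Set (E N)} {F : E N → E N} {M : ℝ}
    (hM : ∀ x ∈ Ω, ‖F x‖ ≤ M) {ρ : E N → ℝ} (hρ : ContDiff ℝ 1 ρ) {q : E N}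
    (hq : IsLocalDefiningFunction Ω q ρ)
    (hlim : ∀ n, IsOutwardUnitNormal Ω q n →
      Tendsto (fun x => inner ℝ (F x) n) (𝓝[Ω] q) (𝓝 0)) :
    Tendsto (fun x => fderiv ℝ ρ x (F x)) (𝓝[Ω] q) (𝓝 0) := by
  have h1 : Tendsto (fun x => fderiv ℝ ρ q (F x)) (𝓝[Ω] q) (𝓝 0) := by
    have h := (hlim _ ⟨ρ, hq, rfl⟩).const_mul ‖gradient ρ q‖
    rw [mul_zero] at h
    refine h.congr fun x => ?_
    rw [inner_smul_right, ← mul_assoc, mul_inv_cancel₀ (norm_ne_zero_iff.2 hq.2.2.1), one_mul,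
      inner_gradient_right]
  have h2 : Tendsto (fun x => (fderiv ℝ ρ x - fderiv ℝ ρ q) (F x)) (𝓝[Ω] q) (𝓝 0) := by
    have hc : Tendsto (fun x => ‖fderiv ℝ ρ x - fderiv ℝ ρ q‖ * M) (𝓝[Ω] q) (𝓝 0) := by
      have hcont : Continuous fun x => ‖fderiv ℝ ρ x - fderiv ℝ ρ q‖ * M :=
        ((hρ.continuous_fderiv one_ne_zero).sub continuous_const).norm.mul continuous_const
      simpa using (hcont.tendsto q).mono_left (nhdsWithin_le_nhds (s := Ω))
    refine squeeze_zero_norm' ?_ hc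
    filter_upwards [self_mem_nhdsWithin] with x hx
    exact (ContinuousLinearMap.le_opNorm _ _).trans
      (mul_le_mul_of_nonneg_left (hM x hx) (norm_nonneg _))
  simpa using h2.add h1

/-- The divergence theorem for a bounded `C^1` field that is tangential at a `C^1` boundary. -/
theorem setIntegral_divergence_eq_zero_of_tangential {Ω : Set (E N)} (hΩ : IsOpen Ω)
    (hb : Bornology.IsBounded Ω) (hC1 : HasC1Boundary Ω) {F : E N → E N}
    (hF : ContDiffOn ℝ 1 F Ω) {M : ℝ} (hM : ∀ x ∈ Ω, ‖F x‖ ≤ M)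
    (hD : IntegrableOn (divergence F) Ω)
    (hlim : ∀ q ∈ frontier Ω, ∀ n, IsOutwardUnitNormal Ω q n →
      Tendsto (fun x => inner ℝ (F x) n) (𝓝[Ω] q) (𝓝 0)) :
    ∫ x in Ω, divergence F x = 0 := by
  have hloc : ∀ p ∈ closure Ω, ∃ U : Set (E N), IsOpen U ∧ p ∈ U ∧ Bornology.IsBounded U ∧
      ∀ ζ : E N → ℝ, ContDiff ℝ 1 ζ → HasCompactSupport ζ → tsupport ζ ⊆ U → (∀ x, 0 ≤ ζ x) →
        ∫ x in Ω, (ζ x * divergence F x + fderiv ℝ ζ x (F x)) = 0 := by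
    intro p hp
    by_cases hpΩ : p ∈ Ω
    · exact ⟨Ω, hΩ, hpΩ, hb, fun ζ hζ hs hsub _ =>
        setIntegral_smul_divergence_add_fderiv hΩ hF hζ hs hsub⟩
    have hpf : p ∈ frontier Ω := by
      rw [hΩ.frontier_eq]
      exact ⟨hp, hpΩ⟩
    obtain ⟨ρ₀, hρ₀⟩ := hC1 p hpf
    obtain ⟨ρ, hρ, hdef⟩ := hρ₀.exists_contDiff
    set e := gradient ρ p with he
    have hepos : 0 < ‖e‖ ^ 2 := by
      have : 0 < ‖e‖ := norm_pos_iff.2 hdef.2.2.1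
      positivity
    -- At `p` the slope along `e = ∇ρ(p)` is `‖e‖ ^ 2`; half of it survives nearby by continuity.
    have hslope : ∀ᶠ x in 𝓝 p, ‖e‖ ^ 2 / 2 < fderiv ℝ ρ x e := by
      have hc : Continuous fun x => fderiv ℝ ρ x e :=
        (hρ.continuous_fderiv one_ne_zero).clm_apply continuous_const
      refine hc.continuousAt.eventually_const_lt ?_
      change ‖e‖ ^ 2 / 2 < fderiv ℝ ρ p e
      rw [← inner_gradient, ← he, real_inner_self_eq_norm_sq]
      linarith
    have hev := ((hdef.2.2.2.and hslope).and (hdef.eventually hΩ hρ)).and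
      (Metric.ball_mem_nhds p one_pos)
    obtain ⟨U, hUsub, hUo, hpU⟩ := mem_nhds_iff.1 hev
    refine ⟨U, hUo, hpU, Metric.isBounded_ball.subset fun x hx => (hUsub hx).2, ?_⟩
    intro ζ hζ hs hsub hζ0
    exact setIntegral_smul_divergence_add_fderiv_of_tangential hΩ hF hM hD hρ
      (fun x hx => (hUsub hx).1.1.1) (half_pos hepos) (fun x hx => (hUsub hx).1.1.2.le)
      (fun q hq hqf => tendsto_fderiv_apply_of_tangential hM hρ ((hUsub hq).1.2 hqf)
        (hlim q hqf)) hζ hs hsub hζ0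
  choose! U hUo hpU hUb hU using hloc
  obtain ⟨t, ht, hcov⟩ := hb.isCompact_closure.elim_nhds_subcover U
    fun p hp => (hUo p hp).mem_nhds (hpU p hp)
  obtain ⟨f, hf⟩ := SmoothPartitionOfUnity.exists_isSubordinate 𝓘(ℝ, E N)
    (isClosed_closure (s := Ω)) (fun i : t => U i) (fun i => hUo i (ht i i.2))
    (by simpa [Set.iUnion_subtype] using hcov)
  have hfs : ∀ i, ContDiff ℝ 1 (f i) := fun i =>
    ((f i).contMDiff.contDiff).of_le (by exact_mod_cast le_top)
  have hfc : ∀ i, HasCompactSupport (f i) := fun i =>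
    Metric.isCompact_of_isClosed_isBounded (isClosed_tsupport _)
      ((hUb i (ht i i.2)).subset (hf i))
  have hsum : ∀ x ∈ Ω, ∑ i, f i x = 1 := fun x hx => by
    rw [← finsum_eq_sum_of_fintype]
    exact f.sum_eq_one (subset_closure hx)
  -- The gradients of the partition cancel in `Ω`, so the local identities add up to the integral of
  -- the divergence alone.
  have hdsum : ∀ x ∈ Ω, ∑ i, fderiv ℝ (f i) x = 0 := fun x hx => by
    rw [← fderiv_fun_sum fun i _ => (hfs i).differentiable one_ne_zero x]
    have h1 : (fun y => ∑ i, f i y) =ᶠ[𝓝 x] fun _ => 1 := by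
      filter_upwards [hΩ.mem_nhds hx] with y hy using hsum y hy
    rw [h1.fderiv_eq]
    simp
  have hsplit : ∀ x ∈ Ω, divergence F x
      = ∑ i, (f i x * divergence F x + fderiv ℝ (f i) x (F x)) := fun x hx => by
    rw [Finset.sum_add_distrib, ← Finset.sum_mul, hsum x hx, one_mul,
      ← sum_apply, hdsum x hx]
    simp
  rw [setIntegral_congr_fun hΩ.measurableSet hsplit, integral_finsetSum]
  · exact Finset.sum_eq_zero fun i _ =>
      hU i (ht i i.2) _ (hfs i) (hfc i) (hf i) fun x => f.nonneg i x
  · exact fun i _ =>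
      integrableOn_smul_divergence_add_fderiv hΩ hF.continuousOn hM hD (hfs i) (hfc i)


/-! ### Wronskian fields and the symmetry of the weighted Laplacian -/

theorem IsClassical.contDiffOn_gradient {Ω : Set (E N)} (hΩ : IsOpen Ω) {w : E N → ℝ}
    (hw : IsClassical Ω w) : ContDiffOn ℝ 1 (gradient w) Ω :=
  (InnerProductSpace.toDual ℝ (E N)).symm.contDiff.comp_contDiffOn
    (hw.1.fderiv_of_isOpen hΩ (by norm_num))

theorem IsClassical.tendsto_gradient {Ω : Set (E N)} {w : E N → ℝ} (hw : IsClassical Ω w) {p : E N}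
    (hp : p ∈ closure Ω) : Tendsto (gradient w) (𝓝[Ω] p) (𝓝 (extendFrom Ω (gradient w) p)) :=
  tendsto_extendFrom (hw.2.2 p hp)

theorem IsClassical.exists_norm_gradient_le {Ω : Set (E N)} (hΩ : IsOpen Ω)
    (hb : Bornology.IsBounded Ω) {w : E N → ℝ} (hw : IsClassical Ω w) :
    ∃ M, ∀ x ∈ Ω, ‖gradient w x‖ ≤ M := by
  obtain ⟨M, hM⟩ := hb.isCompact_closure.exists_bound_of_continuousOn
    (continuousOn_extendFrom subset_rfl hw.2.2)
  refine ⟨M, fun x hx => ?_⟩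
  have h := hM x (subset_closure hx)
  rwa [extendFrom_eq (subset_closure hx) (((hw.contDiffOn_gradient hΩ).continuousOn.continuousAt
    (hΩ.mem_nhds hx)).mono_left nhdsWithin_le_nhds)] at h

theorem integrableOn_exp_mul {Ω : Set (E N)} (hΩ : IsOpen Ω) (hb : Bornology.IsBounded Ω)
    {θ : E N → ℝ} (hθ : ContinuousOn θ Ω) (hθb : BddAbove (θ '' Ω)) {h : E N → ℝ}
    (hh : ContinuousOn h (closure Ω)) : IntegrableOn (fun x => Real.exp (θ x) * h x) Ω := by
  obtain ⟨C, hC⟩ := hθb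
  have hhi : IntegrableOn h Ω :=
    (hh.integrableOn_compact hb.isCompact_closure).mono_set subset_closure
  refine hhi.bdd_mul (c := Real.exp C)
    ((Real.continuous_exp.comp_continuousOn hθ).aestronglyMeasurable hΩ.measurableSet) ?_
  refine (ae_restrict_mem hΩ.measurableSet).mono fun x hx => ?_
  rw [Real.norm_of_nonneg (Real.exp_pos _).le]
  exact Real.exp_le_exp.2 (hC ⟨x, hx, rfl⟩)

/-- The field `w e^θ ∇z - z e^θ ∇w`. -/
noncomputable def wronskianField (θ w z : E N → ℝ) (x : E N) : E N :=
  w x • (Real.exp (θ x) • gradient z x) - z x • (Real.exp (θ x) • gradient w x)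

theorem contDiffOn_exp_smul_gradient {Ω : Set (E N)} (hΩ : IsOpen Ω) {θ w : E N → ℝ}
    (hθ : ContDiffOn ℝ 1 θ Ω) (hw : IsClassical Ω w) :
    ContDiffOn ℝ 1 (fun x => Real.exp (θ x) • gradient w x) Ω :=
  hθ.exp.smul (hw.contDiffOn_gradient hΩ)

theorem contDiffOn_wronskianField {Ω : Set (E N)} (hΩ : IsOpen Ω) {θ w z : E N → ℝ}
    (hθ : ContDiffOn ℝ 1 θ Ω) (hw : IsClassical Ω w) (hz : IsClassical Ω z) :
    ContDiffOn ℝ 1 (wronskianField θ w z) Ω :=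
  ((hw.1.of_le one_le_two).smul (contDiffOn_exp_smul_gradient hΩ hθ hz)).sub
    ((hz.1.of_le one_le_two).smul (contDiffOn_exp_smul_gradient hΩ hθ hw))

/-- The two terms `e^θ ∇w · ∇z` cancel. What remains involves only the operators, so the
differential equations can supply its integrability. -/
theorem divergence_wronskianField {Ω : Set (E N)} (hΩ : IsOpen Ω) {θ w z : E N → ℝ}
    (hθ : ContDiffOn ℝ 1 θ Ω) (hw : IsClassical Ω w) (hz : IsClassical Ω z) {x : E N}
    (hx : x ∈ Ω) : divergence (wronskianField θ w z) x
      = w x * weightedLaplacian θ z x - z x * weightedLaplacian θ w x := by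
  have hmem := hΩ.mem_nhds hx
  have dw : DifferentiableAt ℝ w x := (hw.1.contDiffAt hmem).differentiableAt two_ne_zero
  have dz : DifferentiableAt ℝ z x := (hz.1.contDiffAt hmem).differentiableAt two_ne_zero
  have gw := ((contDiffOn_exp_smul_gradient hΩ hθ hw).contDiffAt hmem).differentiableAt one_ne_zero
  have gz := ((contDiffOn_exp_smul_gradient hΩ hθ hz).contDiffAt hmem).differentiableAt one_ne_zero
  unfold wronskianField
  rw [divergence_sub (dw.fun_smul gz) (dz.fun_smul gw), divergence_smul dw gz, divergence_smul dz gw,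
    ← inner_gradient, ← inner_gradient, inner_smul_right, inner_smul_right,
    real_inner_comm (gradient w x) (gradient z x)]
  unfold weightedLaplacian
  ring

theorem exists_norm_wronskianField_le {Ω : Set (E N)} (hΩ : IsOpen Ω)
    (hb : Bornology.IsBounded Ω) {θ w z : E N → ℝ} (hθb : BddAbove (θ '' Ω))
    (hw : IsClassical Ω w) (hz : IsClassical Ω z) :
    ∃ M, ∀ x ∈ Ω, ‖wronskianField θ w z x‖ ≤ M := by
  obtain ⟨C, hC⟩ := hθb
  obtain ⟨A, hA⟩ := hb.isCompact_closure.exists_bound_of_continuousOn hw.2.1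
  obtain ⟨B, hB⟩ := hb.isCompact_closure.exists_bound_of_continuousOn hz.2.1
  obtain ⟨A', hA'⟩ := hw.exists_norm_gradient_le hΩ hb
  obtain ⟨B', hB'⟩ := hz.exists_norm_gradient_le hΩ hb
  refine ⟨A * (Real.exp C * B') + B * (Real.exp C * A'), fun x hx => ?_⟩
  have hexp : ‖Real.exp (θ x)‖ ≤ Real.exp C := by
    rw [Real.norm_of_nonneg (Real.exp_pos _).le]
    exact Real.exp_le_exp.2 (hC ⟨x, hx, rfl⟩)
  have hA0 := hA x (subset_closure hx)
  have hB0 := hB x (subset_closure hx)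
  have hA1 := hA' x hx
  have hB1 := hB' x hx
  refine (norm_sub_le _ _).trans ?_
  rw [norm_smul, norm_smul, norm_smul, norm_smul]
  have := (norm_nonneg (w x)).trans hA0
  have := (norm_nonneg (z x)).trans hB0
  gcongr

/-- The Robin condition makes the Wronskian field tangential at the boundary. -/
theorem tendsto_inner_wronskianField {Ω : Set (E N)} {θ w z : E N → ℝ}
    (hθb : BddAbove (θ '' Ω)) (hw : IsClassical Ω w) (hz : IsClassical Ω z) {a b : ℝ}
    (hab : a ≠ 0 ∨ b ≠ 0) (rw' : RobinCondition Ω a b w) (rz : RobinCondition Ω a b z) {q : E N}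
    (hq : q ∈ frontier Ω) {n : E N} (hn : IsOutwardUnitNormal Ω q n) :
    Tendsto (fun x => inner ℝ (wronskianField θ w z x) n) (𝓝[Ω] q) (𝓝 0) := by
  have hqc : q ∈ closure Ω := frontier_subset_closure hq
  have tw := (hw.2.1 q hqc).mono_left (nhdsWithin_mono q subset_closure)
  have tz := (hz.2.1 q hqc).mono_left (nhdsWithin_mono q subset_closure)
  have tgw : Tendsto (fun x => inner ℝ (gradient w x) n) (𝓝[Ω] q)
    (𝓝 (boundaryDeriv Ω w q n)) := (hw.tendsto_gradient hqc).inner tendsto_const_nhds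
  have tgz : Tendsto (fun x => inner ℝ (gradient z x) n) (𝓝[Ω] q)
    (𝓝 (boundaryDeriv Ω z q n)) := (hz.tendsto_gradient hqc).inner tendsto_const_nhds
  -- The nonzero vector `(a, b)` lies in the kernel of the matrix with rows `(w, ∂_ν w)` and `(z,
  -- ∂_ν z)`, so its determinant vanishes.
  have hdet : w q * boundaryDeriv Ω z q n - z q * boundaryDeriv Ω w q n = 0 := by
    have h1 := rw' q hq n hn
    have h2 := rz q hq n hn
    rcases hab with h | h
    · refine (mul_eq_zero.1 (?_ : a * _ = 0)).resolve_left h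
      linear_combination boundaryDeriv Ω z q n * h1 - boundaryDeriv Ω w q n * h2
    · refine (mul_eq_zero.1 (?_ : b * _ = 0)).resolve_left h
      linear_combination w q * h2 - z q * h1
  have ht := (tw.mul tgz).sub (tz.mul tgw)
  rw [hdet] at ht
  obtain ⟨C, hC⟩ := hθb
  have hbd : IsBoundedUnder (· ≤ ·) (𝓝[Ω] q) (norm ∘ fun x => Real.exp (θ x)) := by
    refine isBoundedUnder_of_eventually_le (a := Real.exp C) ?_
    filter_upwards [self_mem_nhdsWithin] with x hx
    simp only [Function.comp, Real.norm_of_nonneg (Real.exp_pos _).le]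
    exact Real.exp_le_exp.2 (hC ⟨x, hx, rfl⟩)
  refine (isBoundedUnder_le_mul_tendsto_zero hbd ht).congr fun x => ?_
  simp only [wronskianField, inner_sub_left, real_inner_smul_left]
  ring

/-- The weighted Laplacian with Robin boundary conditions is symmetric. -/
theorem setIntegral_mul_weightedLaplacian_sub {Ω : Set (E N)} (hΩ : IsOpen Ω)
    (hb : Bornology.IsBounded Ω) (hC1 : HasC1Boundary Ω) {θ w z : E N → ℝ}
    (hθ : ContDiffOn ℝ 1 θ Ω) (hθb : BddAbove (θ '' Ω)) (hw : IsClassical Ω w)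
    (hz : IsClassical Ω z) {a b : ℝ} (hab : a ≠ 0 ∨ b ≠ 0) (rw' : RobinCondition Ω a b w)
    (rz : RobinCondition Ω a b z)
    (hi : IntegrableOn (fun x => w x * weightedLaplacian θ z x - z x * weightedLaplacian θ w x) Ω) :
    ∫ x in Ω, (w x * weightedLaplacian θ z x - z x * weightedLaplacian θ w x) = 0 := by
  have hdiv := fun x (hx : x ∈ Ω) => divergence_wronskianField hΩ hθ hw hz hx
  obtain ⟨M, hM⟩ := exists_norm_wronskianField_le hΩ hb hθb hw hz
  rw [← setIntegral_congr_fun hΩ.measurableSet hdiv]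
  exact setIntegral_divergence_eq_zero_of_tangential hΩ hb hC1
    (contDiffOn_wronskianField hΩ hθ hw hz) hM
    (hi.congr_fun (fun x hx => (hdiv x hx).symm) hΩ.measurableSet)
    fun q hq n hn => tendsto_inner_wronskianField hθb hw hz hab rw' rz hq hn

/-! ### Testing the linearised problem against the solution -/

/-- The identity obtained by testing the linearised problem against the solution. -/
theorem setIntegral_linearised_eq_zero {Ω : Set (E N)} (hΩ : IsOpen Ω)
    (hb : Bornology.IsBounded Ω) (hC1 : HasC1Boundary Ω) {θ : E N → ℝ}
    (hθ : ContDiffOn ℝ 1 θ Ω) (hθb : BddAbove (θ '' Ω)) {a b : ℝ} (hab : a ≠ 0 ∨ b ≠ 0)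
    {lam gam : ℝ} {f g : ℝ → ℝ} (hf : ContDiff ℝ 2 f) (hg : ContDiff ℝ 2 g) {u v : E N → ℝ}
    (huv : IsPositiveSolution Ω θ a b lam gam f g u v) {η : ℝ} {φ ψ : E N → ℝ}
    (h : SolvesLinearised Ω θ a b lam gam f g u v η φ ψ) :
    IntegrableOn (fun x => Real.exp (θ x) * (lam * (v x * deriv f (v x) - f (v x)) * ψ x
      + gam * (u x * deriv g (u x) - g (u x)) * φ x) + η * (u x * ψ x + v x * φ x)) Ω ∧
    ∫ x in Ω, (Real.exp (θ x) * (lam * (v x * deriv f (v x) - f (v x)) * ψ x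
      + gam * (u x * deriv g (u x) - g (u x)) * φ x) + η * (u x * ψ x + v x * φ x)) = 0 := by
  have cu := huv.classical_u.2.1
  have cv := huv.classical_v.2.1
  have cφ := h.classical_φ.2.1
  have cψ := h.classical_ψ.2.1
  have cf := hf.continuous.comp_continuousOn cv
  have cg := hg.continuous.comp_continuousOn cu
  have cf' := (hf.continuous_deriv one_le_two).comp_continuousOn cv
  have cg' := (hg.continuous_deriv one_le_two).comp_continuousOn cu
  have hint : ∀ {p q : E N → ℝ}, ContinuousOn p (closure Ω) → ContinuousOn q (closure Ω) →
      IntegrableOn (fun x => Real.exp (θ x) * p x + q x) Ω := fun hp hq =>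
    (integrableOn_exp_mul hΩ hb hθ.continuousOn hθb hp).add
      ((hq.integrableOn_compact hb.isCompact_closure).mono_set subset_closure)
  -- Pairing `u` with `ψ` and `v` with `φ` makes `f(v) ψ` here meet `v f'(v) ψ` in `e2`, and
  -- likewise for `g`.
  have e1 : ∀ x ∈ Ω, u x * weightedLaplacian θ ψ x - ψ x * weightedLaplacian θ u x
      = Real.exp (θ x) * (lam * f (v x) * ψ x - gam * u x * deriv g (u x) * φ x)
        + -(η * (u x * ψ x)) := fun x hx => by
    linear_combination ψ x * huv.eq_u x hx - u x * h.eq_ψ x hx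
  have e2 : ∀ x ∈ Ω, v x * weightedLaplacian θ φ x - φ x * weightedLaplacian θ v x
      = Real.exp (θ x) * (gam * g (u x) * φ x - lam * v x * deriv f (v x) * ψ x)
        + -(η * (v x * φ x)) := fun x hx => by
    linear_combination φ x * huv.eq_v x hx - v x * h.eq_φ x hx
  have i1 := hint (((continuousOn_const (c := lam)).mul cf).mul cψ |>.sub
    ((((continuousOn_const (c := gam)).mul cu).mul cg').mul cφ))
    ((continuousOn_const (c := η)).mul (cu.mul cψ)).neg
  have i2 := hint (((continuousOn_const (c := gam)).mul cg).mul cφ |>.sub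
    ((((continuousOn_const (c := lam)).mul cv).mul cf').mul cψ))
    ((continuousOn_const (c := η)).mul (cv.mul cφ)).neg
  have z1 := setIntegral_mul_weightedLaplacian_sub hΩ hb hC1 hθ hθb huv.classical_u
    h.classical_ψ hab huv.robin_u h.robin_ψ
    (i1.congr_fun (fun x hx => (e1 x hx).symm) hΩ.measurableSet)
  have z2 := setIntegral_mul_weightedLaplacian_sub hΩ hb hC1 hθ hθb huv.classical_v
    h.classical_φ hab huv.robin_v h.robin_φ
    (i2.congr_fun (fun x hx => (e2 x hx).symm) hΩ.measurableSet)
  rw [setIntegral_congr_fun hΩ.measurableSet e1] at z1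
  rw [setIntegral_congr_fun hΩ.measurableSet e2] at z2
  have hsum := integral_add i1 i2
  have hfun : ∀ x, Real.exp (θ x) * (lam * (v x * deriv f (v x) - f (v x)) * ψ x
      + gam * (u x * deriv g (u x) - g (u x)) * φ x) + η * (u x * ψ x + v x * φ x)
      = -((Real.exp (θ x) * (lam * f (v x) * ψ x - gam * u x * deriv g (u x) * φ x)
        + -(η * (u x * ψ x)))
      + (Real.exp (θ x) * (gam * g (u x) * φ x - lam * v x * deriv f (v x) * ψ x)
        + -(η * (v x * φ x)))) := fun x => by ring
  simp_rw [hfun]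
  refine ⟨(i1.add i2).neg, ?_⟩
  rw [integral_neg, neg_eq_zero]
  refine hsum.trans ?_
  exact (congrArg₂ (· + ·) z1 z2).trans (add_zero 0)

/-! ### Sign of `t h'(t) - h(t)` and of the eigenvalue -/

/-- The derivative is `t h''(t)` and the value at `0` is `-h(0)`. Strictness comes from the starting
value if `h(0) < 0`, and from strict monotonicity if `h(0) = 0`. -/
theorem mul_deriv_sub_pos_of_mem_ClassX {h : ℝ → ℝ} (hX : h ∈ ClassX) {t : ℝ} (ht : 0 < t) :
    0 < t * deriv h t - h t := by
  obtain ⟨hc, hcase⟩ := hX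
  have hd : Differentiable ℝ h := hc.differentiable two_ne_zero
  have hd' : Differentiable ℝ (deriv h) :=
    ((contDiff_succ_iff_deriv (n := 1)).1 hc).2.2.differentiable one_ne_zero
  have hk : ∀ s, HasDerivAt (fun s => s * deriv h s - h s) (s * iteratedDeriv 2 h s) s := by
    intro s
    have := ((hasDerivAt_id s).mul (hd' s).hasDerivAt).sub (hd s).hasDerivAt
    rw [iteratedDeriv_succ, iteratedDeriv_one]
    exact this.congr_deriv (by simp)
  have hcont : ContinuousOn (fun s => s * deriv h s - h s) (Set.Ici 0) :=
    fun s _ => (hk s).continuousAt.continuousWithinAt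
  rcases hcase with ⟨h0, h2⟩ | ⟨h0, h2⟩
  · have hm : MonotoneOn (fun s => s * deriv h s - h s) (Set.Ici 0) := by
      refine monotoneOn_of_deriv_nonneg (convex_Ici 0) hcont
        (fun s _ => (hk s).differentiableAt.differentiableWithinAt) fun s hs => ?_
      rw [interior_Ici, Set.mem_Ioi] at hs
      rw [(hk s).deriv]
      exact mul_nonneg hs.le (h2 s hs)
    have := hm Set.self_mem_Ici ht.le ht.le
    simp only [zero_mul] at this
    linarith
  · have hm : StrictMonoOn (fun s => s * deriv h s - h s) (Set.Ici 0) := by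
      refine strictMonoOn_of_deriv_pos (convex_Ici 0) hcont fun s hs => ?_
      rw [interior_Ici, Set.mem_Ioi] at hs
      rw [(hk s).deriv]
      exact mul_pos hs (h2 s hs)
    have := hm Set.self_mem_Ici ht.le ht
    simp only [zero_mul] at this
    linarith

theorem neg_mem_ClassX {h : ℝ → ℝ} (hY : h ∈ ClassY) : (fun t => -h t) ∈ ClassX := by
  obtain ⟨hc, hcase⟩ := hY
  have h2 : ∀ t, iteratedDeriv 2 (fun t => -h t) t = -iteratedDeriv 2 h t := fun t =>
    iteratedDeriv_fun_neg 2 h t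
  refine ⟨hc.neg, ?_⟩
  simpa [h2] using hcase

theorem mul_deriv_sub_neg_of_mem_ClassY {h : ℝ → ℝ} (hY : h ∈ ClassY) {t : ℝ} (ht : 0 < t) :
    t * deriv h t - h t < 0 := by
  have := mul_deriv_sub_pos_of_mem_ClassX (neg_mem_ClassX hY) ht
  rw [deriv.fun_neg] at this
  linarith

theorem setIntegral_pos_of_pos {Ω : Set (E N)} (hΩ : IsOpen Ω) (hne : Ω.Nonempty) {F : E N → ℝ}
    (hi : IntegrableOn F Ω) (hF : ∀ x ∈ Ω, 0 < F x) : 0 < ∫ x in Ω, F x := by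
  rw [setIntegral_pos_iff_support_of_nonneg_ae
    ((ae_restrict_mem hΩ.measurableSet).mono fun x hx => (hF x hx).le) hi]
  have : Function.support F ∩ Ω = Ω := Set.inter_eq_right.2 fun x hx => (hF x hx).ne'
  rw [this]
  exact hΩ.measure_pos volume hne

/-- If `η ≥ 0`, the integrand of the tested identity is positive throughout `Ω`, so its integral
cannot vanish. -/
theorem eigenvalue_neg_of_mem_ClassX {Ω : Set (E N)} (hΩ : IsOpen Ω)
    (hb : Bornology.IsBounded Ω) (hne : Ω.Nonempty) (hC1 : HasC1Boundary Ω) {θ : E N → ℝ}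
    (hθ : ContDiffOn ℝ 1 θ Ω) (hθb : BddAbove (θ '' Ω)) {a b : ℝ} (hab : a ≠ 0 ∨ b ≠ 0)
    {lam gam : ℝ} (hlam : 0 < lam) (hgam : 0 < gam) {f g : ℝ → ℝ} {u v : E N → ℝ}
    (huv : IsPositiveSolution Ω θ a b lam gam f g u v) (hf : f ∈ ClassX) (hg : g ∈ ClassX) {η : ℝ}
    (h : HasPositiveEigenpair Ω θ a b lam gam f g u v η) : η < 0 := by
  obtain ⟨φ, ψ, hs, hφ, hψ⟩ := h
  obtain ⟨hi, hz⟩ := setIntegral_linearised_eq_zero hΩ hb hC1 hθ hθb hab hf.1 hg.1 huv hs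
  by_contra hη
  rw [not_lt] at hη
  refine (setIntegral_pos_of_pos hΩ hne hi fun x hx => ?_).ne' hz
  have hfx := mul_deriv_sub_pos_of_mem_ClassX hf (huv.pos_v x hx)
  have hgx := mul_deriv_sub_pos_of_mem_ClassX hg (huv.pos_u x hx)
  have := huv.pos_u x hx
  have := huv.pos_v x hx
  have := hφ x hx
  have := hψ x hx
  positivity

theorem eigenvalue_pos_of_mem_ClassY {Ω : Set (E N)} (hΩ : IsOpen Ω)
    (hb : Bornology.IsBounded Ω) (hne : Ω.Nonempty) (hC1 : HasC1Boundary Ω) {θ : E N → ℝ}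
    (hθ : ContDiffOn ℝ 1 θ Ω) (hθb : BddAbove (θ '' Ω)) {a b : ℝ} (hab : a ≠ 0 ∨ b ≠ 0)
    {lam gam : ℝ} (hlam : 0 < lam) (hgam : 0 < gam) {f g : ℝ → ℝ} {u v : E N → ℝ}
    (huv : IsPositiveSolution Ω θ a b lam gam f g u v) (hf : f ∈ ClassY) (hg : g ∈ ClassY) {η : ℝ}
    (h : HasPositiveEigenpair Ω θ a b lam gam f g u v η) : 0 < η := by
  obtain ⟨φ, ψ, hs, hφ, hψ⟩ := h
  obtain ⟨hi, hz⟩ := setIntegral_linearised_eq_zero hΩ hb hC1 hθ hθb hab hf.1 hg.1 huv hs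
  by_contra hη
  rw [not_lt] at hη
  have hpos := setIntegral_pos_of_pos hΩ hne hi.neg fun x hx => ?_
  · simp only [Pi.neg_apply, integral_neg, hz, neg_zero, lt_self_iff_false] at hpos
  have hfx := neg_pos.2 (mul_deriv_sub_neg_of_mem_ClassY hf (huv.pos_v x hx))
  have hgx := neg_pos.2 (mul_deriv_sub_neg_of_mem_ClassY hg (huv.pos_u x hx))
  have hη' := neg_nonneg.2 hη
  have := huv.pos_u x hx
  have := huv.pos_v x hx
  have := hφ x hx
  have := hψ x hx
  have key : 0 < Real.exp (θ x) * (lam * -(v x * deriv f (v x) - f (v x)) * ψ x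
      + gam * -(u x * deriv g (u x) - g (u x)) * φ x) + -η * (u x * ψ x + v x * φ x) := by
    positivity
  simp only [Pi.neg_apply]
  linarith

end RobinSystem

theorem mainTheorem7 {N : ℕ} (Ω : Set (RobinSystem.E N))
    (hΩ_open : IsOpen Ω) (hΩ_bdd : Bornology.IsBounded Ω) (hΩ_ne : Ω.Nonempty)
    (hΩ_C1 : RobinSystem.HasC1Boundary Ω)
    (θ : RobinSystem.E N → ℝ) (hθ : ContDiffOn ℝ 1 θ Ω) (hθ_bdd : BddAbove (θ '' Ω))
    (a b : ℝ) (hab : a ≠ 0 ∨ b ≠ 0)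
    (lam gam : ℝ) (hlam : 0 < lam) (hgam : 0 < gam)
    (f g : ℝ → ℝ) (u v : RobinSystem.E N → ℝ)
    (huv : RobinSystem.IsPositiveSolution Ω θ a b lam gam f g u v) :
    (f ∈ RobinSystem.ClassX → g ∈ RobinSystem.ClassX →
      RobinSystem.IsUnstable Ω θ a b lam gam f g u v ∧
      ∀ η : ℝ, RobinSystem.HasPositiveEigenpair Ω θ a b lam gam f g u v η → η < 0) ∧
    (f ∈ RobinSystem.ClassY → g ∈ RobinSystem.ClassY →
      ((∃ η : ℝ, RobinSystem.IsFirstEigenvalue Ω θ a b lam gam f g u v η) →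
        RobinSystem.IsStable Ω θ a b lam gam f g u v) ∧
      ∀ η : ℝ, RobinSystem.HasPositiveEigenpair Ω θ a b lam gam f g u v η → 0 < η) := by
  refine ⟨fun hf hg => ?_, fun hf hg => ?_⟩
  · have hneg : ∀ η : ℝ, RobinSystem.HasPositiveEigenpair Ω θ a b lam gam f g u v η → η < 0 :=
      fun η h => RobinSystem.eigenvalue_neg_of_mem_ClassX hΩ_open hΩ_bdd hΩ_ne hΩ_C1 hθ hθ_bdd hab
        hlam hgam huv hf hg h
    -- A first eigenvalue carries a positive eigenpair, hence is negative; if there is none,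
    -- semi-stability fails outright.
    exact ⟨fun ⟨η, hη, hfirst⟩ => (hneg η hfirst.2).not_ge hη, hneg⟩
  · have hpos : ∀ η : ℝ, RobinSystem.HasPositiveEigenpair Ω θ a b lam gam f g u v η → 0 < η :=
      fun η h => RobinSystem.eigenvalue_pos_of_mem_ClassY hΩ_open hΩ_bdd hΩ_ne hΩ_C1 hθ hθ_bdd hab
        hlam hgam huv hf hg h
    exact ⟨fun ⟨η, hfirst⟩ => ⟨η, hpos η hfirst.2, hfirst⟩, hpos⟩
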